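/- Let $S_n$ be the set of permutations of $\{1,\dots,n\}$. For $\pi\in S_n$ let $\mathrm{fp}(\pi)$, $\mathrm{exc}(\pi)$, $\mathrm{dexc}(\pi)$, $\mathrm{cyc}(\pi)$, $\mathrm{inv}(\pi)$ be, respectively, the number of $i$ with $\pi(i)=i$, of $i$ with $i<\pi(i)$, of $i$ with $i<\pi(i)<\pi(\pi(i))$, of cycles (fixed points included), and of inversions of $\pi$. Say that $\pi$ has *noncrossing cycles* if there are no $i<j<k<l$ such that $i,k$ belong to one cycle of $\pi$ and $j,l$ to another; that a cycle is *unimodal* if, written with its smallest element first as $(a_1,\dots,a_k)$, it satisfies $a_1<\dots<a_i>\dots>a_k$ for some $1\le i\le k$; and that a fixed point $j$ is *nested* if there are $i<j<k$ with $\pi(i)=k$ or $\pi(k)=i$. Let $U_n\subseteq S_n$ be the set of permutations all of whose cycles are unimodal, that have noncrossing cycles, and that have no nested fixed point. Then: 1. $|U_n|=C_n=\frac1{n+1}\binom{2n}{n}$ for every $n\ge0$. 2. For every $n\ge 0$, the joint distribution of $(\mathrm{fp},\mathrm{exc},\mathrm{dexc})$ on $U_n$ equals its joint distribution on the set of $321$-avoiding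 permutations in $S_n$ (those without a decreasing subsequence of length $3$). 3. As formal power series in $z$, $$\sum_{n\ge0}\sum_{\pi\in U_n} x^{\mathrm{fp}(\pi)}v^{\mathrm{exc}(\pi)}w^{\mathrm{dexc}(\pi)}t^{\mathrm{cyc}(\pi)}q^{\mathrm{inv}(\pi)}z^n=\cfrac{1}{1-\ell_0z-\cfrac{d_1z^2}{1-\ell_1z-\cfrac{d_2z^2}{1-\ell_2z-\cdots}}},$$ where $\ell_0=xt$, and $d_h=vt\,q^{4h-3}$ and $\ell_h=(1+vw)\,q^{2h-1}$ for $h\ge1$. -/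

import Mathlib

namespace PermCycles

section Permutations

variable {n : ℕ}

/-- Number of fixed points of `π`. -/
def fp (π : Equiv.Perm (Fin n)) : ℕ :=
  (Finset.univ.filter fun i : Fin n => π i = i).card

/-- Number of excedances of `π`: positions `i` with `i < π i`. -/
def exc (π : Equiv.Perm (Fin n)) : ℕ :=
  (Finset.univ.filter fun i : Fin n => i < π i).card

/-- Number of double excedances of `π`: positions `i` with `i < π i < π (π i)`. -/
def dexc (π : Equiv.Perm (Fin n)) : ℕ :=
  (Finset.univ.filter fun i : Fin n => i < π i ∧ π i < π (π i)).card

/-- Number of cycles of `π`, where each fixed point counts as a cycle. -/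
noncomputable def cyc (π : Equiv.Perm (Fin n)) : ℕ :=
  Nat.card (Quotient (Equiv.Perm.SameCycle.setoid π))

/-- Number of inversions of `π`: pairs `i < j` with `π i > π j`. -/
def inv (π : Equiv.Perm (Fin n)) : ℕ :=
  (Finset.univ.filter fun p : Fin n × Fin n => p.1 < p.2 ∧ π p.2 < π p.1).card

/-- There are no `i < j < k < l` such that `i, k` belong to one cycle and `j, l` to another. -/
def NoncrossingCycles (π : Equiv.Perm (Fin n)) : Prop :=
  ¬ ∃ i j k l : Fin n, i < j ∧ j < k ∧ k < l ∧
    π.SameCycle i k ∧ π.SameCycle j l ∧ ¬ π.SameCycle i j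

/-- The cycle of `π` through `a`, written `(a, π a, π² a, …)` starting with `a`, increases up to
some position `m` (counted from `0`) and decreases from there to its last entry. The length of
the cycle is the minimal period of `a` under `π`. -/
def UnimodalFrom (π : Equiv.Perm (Fin n)) (a : Fin n) : Prop :=
  ∃ m < Function.minimalPeriod π a,
    (∀ s, s < m → (π ^ s) a < (π ^ (s + 1)) a) ∧
    (∀ s, m ≤ s → s + 1 < Function.minimalPeriod π a → (π ^ (s + 1)) a < (π ^ s) a)

/-- Every cycle of `π`, written with its smallest element first, is unimodal. -/
def UnimodalCycles (π : Equiv.Perm (Fin n)) : Prop :=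
  ∀ a : Fin n, (∀ b, π.SameCycle a b → a ≤ b) → UnimodalFrom π a

/-- A fixed point `j` of `π` is nested if there are `i < j < k` with `π i = k` or `π k = i`. -/
def IsNestedFixedPoint (π : Equiv.Perm (Fin n)) (j : Fin n) : Prop :=
  π j = j ∧ ∃ i k : Fin n, i < j ∧ j < k ∧ (π i = k ∨ π k = i)

/-- `π` has no decreasing subsequence of length three. -/
def Avoids321 (π : Equiv.Perm (Fin n)) : Prop :=
  ¬ ∃ i j k : Fin n, i < j ∧ j < k ∧ π k < π j ∧ π j < π i

end Permutations

open Classical in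
/-- The permutations of an `n`-element chain with unimodal noncrossing cycles and no nested fixed
points. -/
noncomputable def unimodalNoncrossing (n : ℕ) : Finset (Equiv.Perm (Fin n)) :=
  Finset.univ.filter fun π =>
    UnimodalCycles π ∧ NoncrossingCycles π ∧ ∀ j, ¬ IsNestedFixedPoint π j

open Classical in
/-- The `321`-avoiding permutations of an `n`-element chain. -/
noncomputable def avoiding321 (n : ℕ) : Finset (Equiv.Perm (Fin n)) :=
  Finset.univ.filter fun π => Avoids321 π

section JFraction

variable {R : Type*} [CommRing R]

/-- Finite convergents: `jConvergent d l N h` is the finite continued fraction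
`1 / (1 - l h z - d (h+1) z² / (1 - l (h+1) z - ⋯ - d (h+N) z² / (1 - l (h+N) z)))`
as a formal power series in `z`. All denominators have constant coefficient `1`. -/
noncomputable def jConvergent (d l : ℕ → R) : ℕ → ℕ → PowerSeries R
  | 0, h => PowerSeries.invOfUnit (1 - PowerSeries.C (l h) * PowerSeries.X) 1
  | N + 1, h => PowerSeries.invOfUnit
      (1 - PowerSeries.C (l h) * PowerSeries.X
        - PowerSeries.C (d (h + 1)) * PowerSeries.X ^ 2 * jConvergent d l N (h + 1)) 1

/-- The infinite continued fraction
`1 / (1 - l 0 z - d 1 z² / (1 - l 1 z - d 2 z² / (1 - l 2 z - ⋯)))`: the limit of its convergents,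
whose coefficient of `z ^ n` is the same in all convergents from the `n`-th on
(see `coeff_jConvergent`). The value `d 0` is not used. -/
noncomputable def jFraction (d l : ℕ → R) : PowerSeries R :=
  PowerSeries.mk fun n => PowerSeries.coeff n (jConvergent d l n 0)

theorem invOfUnit_sub_dvd {a b c : PowerSeries R}
    (ha : PowerSeries.constantCoeff a = 1) (hb : PowerSeries.constantCoeff b = 1)
    (h : c ∣ a - b) : c ∣ PowerSeries.invOfUnit a 1 - PowerSeries.invOfUnit b 1 := by
  have h1 : a * PowerSeries.invOfUnit a 1 = 1 := PowerSeries.mul_invOfUnit a 1 (by simpa using ha)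
  have h2 : b * PowerSeries.invOfUnit b 1 = 1 := PowerSeries.mul_invOfUnit b 1 (by simpa using hb)
  obtain ⟨e, he⟩ := h
  refine ⟨-(PowerSeries.invOfUnit a 1 * PowerSeries.invOfUnit b 1 * e), ?_⟩
  linear_combination (PowerSeries.invOfUnit b 1) * h1 - (PowerSeries.invOfUnit a 1) * h2
    - PowerSeries.invOfUnit a 1 * PowerSeries.invOfUnit b 1 * he

theorem jConvergent_sub_dvd (d l : ℕ → R) (N M h : ℕ) (hNM : N ≤ M) :
    PowerSeries.X ^ (2 * N + 2) ∣ jConvergent d l M h - jConvergent d l N h := by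
  induction N generalizing M h with
  | zero =>
    cases M with
    | zero => simp
    | succ M =>
      rw [jConvergent, jConvergent]
      refine invOfUnit_sub_dvd (by simp) (by simp)
        ⟨-(PowerSeries.C (d (h + 1)) * jConvergent d l M (h + 1)), by ring⟩
  | succ N ih =>
    cases M with
    | zero => omega
    | succ M =>
      rw [jConvergent, jConvergent]
      obtain ⟨e, he⟩ := ih M (h + 1) (by omega)
      refine invOfUnit_sub_dvd (by simp) (by simp) ⟨-(PowerSeries.C (d (h + 1)) * e), ?_⟩
      linear_combination -(PowerSeries.C (d (h + 1)) * PowerSeries.X ^ 2) * he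

/-- The convergents converge coefficientwise to the infinite continued fraction. -/
theorem coeff_jConvergent (d l : ℕ → R) (n N : ℕ) (h : n ≤ N) :
    PowerSeries.coeff n (jConvergent d l N 0) = PowerSeries.coeff n (jFraction d l) := by
  have h1 := PowerSeries.X_pow_dvd_iff.1 (jConvergent_sub_dvd d l n N 0 h) n (by omega)
  rw [map_sub, sub_eq_zero] at h1
  rw [h1, jFraction, PowerSeries.coeff_mk]

end JFraction

end PermCycles

open PermCycles

/-! Reading a permutation `π` from left to right as an arc diagram, each point is a fixed point, a
valley, a peak, a double rise or a double fall, and the word of these letters is a Motzkin path with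
coloured level steps, whose height over a gap is the number of arcs `i → π i` that jump over that
gap to the right (equivalently, to the left). No fixed point is nested if and only if the word has
fixed points at height zero only.

Given such a word, `π` is determined by the order in which it closes the arcs that the word opens.
Closing them first in, first out, in both directions, gives the `321`-avoiding permutations. Closing
them last in, first out gives the unimodal noncrossing ones: two points that are not fixed then
belong to one cycle if and only if they are at the same level and the path stays at or above that
level between them, so that every such cycle has a single valley. Hence both families are in
bijection with the Motzkin words, and `fp`, `exc` and `dexc` depend on the word only. For unimodal
noncrossing permutations the same holds for `cyc` and for `inv`, to which each letter contributes an
amount that depends on its height. Summing over paths gives Flajolet's continued fraction, and with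
all weights equal to `1` the Catalan numbers. -/

namespace PermCycles

open Finset

section Rearrangement

theorem sum_mul_comp_swap_lt {ι R : Type*} [Fintype ι] [DecidableEq ι] [CommRing R]
    [LinearOrder R] [IsStrictOrderedRing R] {f g : ι → R} {i j : ι} (hf : f i < f j)
    (hg : g i < g j) : ∑ k, f k * g (Equiv.swap i j k) < ∑ k, f k * g k := by
  have hij : i ≠ j := fun h => hf.ne (congrArg f h)
  have hdiff : ∑ k, (f k * g k - f k * g (Equiv.swap i j k)) = (f j - f i) * (g j - g i) := by
    rw [Fintype.sum_eq_add i j hij fun k hk => by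
      rw [Equiv.swap_apply_of_ne_of_ne hk.1 hk.2, sub_self],
      Equiv.swap_apply_left, Equiv.swap_apply_right]
    ring
  rw [← sub_pos, ← sum_sub_distrib, hdiff]
  exact mul_pos (sub_pos.2 hf) (sub_pos.2 hg)

theorem exists_perm_strictMonoOn {α : Type*} [Fintype α] [LinearOrder α] {A B : Finset α}
    (h : #A = #B) :
    ∃ π : Equiv.Perm α, (∀ i, π i ∈ B ↔ i ∈ A) ∧ StrictMonoOn π A ∧ StrictMonoOn π ↑Aᶜ := by
  have hc : #Bᶜ = #Aᶜ := by rw [card_compl, card_compl, h]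
  let e : A ≃o B := (A.orderIsoOfFin rfl).symm.trans (B.orderIsoOfFin h.symm)
  let e' : ↥Aᶜ ≃o ↥Bᶜ := (Aᶜ.orderIsoOfFin rfl).symm.trans (Bᶜ.orderIsoOfFin hc)
  let π : Equiv.Perm α := Equiv.subtypeCongr e.toEquiv
    ((Equiv.subtypeEquivRight fun _ => mem_compl.symm).trans
      (e'.toEquiv.trans (Equiv.subtypeEquivRight fun _ => mem_compl)))
  have hπ : ∀ i (hi : i ∈ A), π i = e ⟨i, hi⟩ := fun i hi => by
    simp [π, Equiv.subtypeCongr, hi]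
  have hπ' : ∀ i (hi : i ∈ Aᶜ), π i = e' ⟨i, hi⟩ := fun i hi => by
    simp [π, Equiv.subtypeCongr, mem_compl.1 hi]
    rfl
  refine ⟨π, fun i => ?_, fun i hi j hj hij => ?_, fun i hi j hj hij => ?_⟩
  · by_cases hi : i ∈ A
    · rw [hπ i hi]
      exact iff_of_true (e _).2 hi
    · rw [hπ' i (mem_compl.2 hi)]
      exact iff_of_false (mem_compl.1 (e' _).2) hi
  · rw [hπ i hi, hπ j hj]
    exact e.lt_iff_lt.2 hij
  · rw [hπ' i hi, hπ' j hj]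
    exact e'.lt_iff_lt.2 hij

theorem card_filter_lt_perm_apply {α : Type*} [LinearOrder α] {π : Equiv.Perm α} {A B : Finset α}
    (hAB : ∀ i, π i ∈ B ↔ i ∈ A) (hπ : StrictMonoOn π A) {i : α} (hi : i ∈ A) :
    #{b ∈ B | b < π i} = #{a ∈ A | a < i} := by
  refine (card_equiv π fun a => ?_).symm
  simp only [mem_filter, hAB]
  exact and_congr_right fun ha => (hπ.lt_iff_lt ha hi).symm

theorem lt_perm_apply_iff {α : Type*} [LinearOrder α] {π : Equiv.Perm α} {A B : Finset α}
    (hAB : ∀ i, π i ∈ B ↔ i ∈ A) (hπ : StrictMonoOn π A) {i : α} (hi : i ∈ A) :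
    i < π i ↔ #{b ∈ B | b ≤ i} ≤ #{a ∈ A | a < i} := by
  rw [← card_filter_lt_perm_apply hAB hπ hi]
  refine ⟨fun h => card_le_card (monotone_filter_right B fun b _ hb => hb.trans_lt h), ?_⟩
  contrapose!
  refine fun h => card_lt_card ⟨monotone_filter_right B fun b _ hb => hb.le.trans h, fun hsub => ?_⟩
  exact (mem_filter.1 (hsub (mem_filter.2 ⟨(hAB i).2 hi, h⟩))).2.false

theorem perm_apply_lt_iff {α : Type*} [LinearOrder α] {π : Equiv.Perm α} {A B : Finset α}
    (hAB : ∀ i, π i ∈ B ↔ i ∈ A) (hπ : StrictMonoOn π A) {i : α} (hi : i ∈ A) :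
    π i < i ↔ #{a ∈ A | a < i} < #{b ∈ B | b < i} := by
  rw [← card_filter_lt_perm_apply hAB hπ hi]
  constructor
  · refine fun h => card_lt_card ⟨monotone_filter_right B fun b _ hb => hb.trans h, fun hsub => ?_⟩
    exact (mem_filter.1 (hsub (mem_filter.2 ⟨(hAB i).2 hi, h⟩))).2.false
  · contrapose!
    exact fun h => card_le_card (monotone_filter_right B fun b _ hb => hb.trans_le h)

theorem exists_unimodal_index {α : Type*} [LinearOrder α] {f : ℕ → α} {N : ℕ} (hN : 0 < N)
    (hne : ∀ s, s + 1 < N → f s ≠ f (s + 1))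
    (hvalley : ∀ s, s + 2 < N → f (s + 1) < f s → ¬ f (s + 1) < f (s + 2)) :
    ∃ m < N, (∀ s < m, f s < f (s + 1)) ∧ ∀ s, m ≤ s → s + 1 < N → f (s + 1) < f s := by
  have hex : ∃ s, N ≤ s + 1 ∨ f (s + 1) < f s := ⟨N, Or.inl N.le_succ⟩
  refine ⟨Nat.find hex, ?_, fun s hs => ?_, fun s hs => ?_⟩
  · have := Nat.find_min' hex (m := N - 1) (Or.inl (by omega))
    omega
  · obtain ⟨hsN, hle⟩ := not_or.1 (Nat.find_min hex hs)
    exact (not_lt.1 hle).lt_of_ne (hne s (not_le.1 hsN))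
  · induction s, hs using Nat.le_induction with
    | base => exact fun hN => (Nat.find_spec hex).resolve_left hN.not_ge
    | succ s _ ih =>
      intro hsN
      exact (not_lt.1 (hvalley s hsN (ih (by omega)))).lt_of_ne (hne _ hsN).symm

end Rearrangement

section Words

variable {n : ℕ} {π σ : Equiv.Perm (Fin n)} {i j : Fin n}

theorem inv_apply_eq_iff : π⁻¹ i = j ↔ π j = i := by
  rw [Equiv.Perm.inv_eq_iff_eq, eq_comm]

/-- The local shapes of a permutation at a point, the letters of the words that encode
permutations. -/
inductive Letter
  | fixed
  | valley
  | peak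
  | doubleRise
  | doubleFall
  deriving DecidableEq

instance : Fintype Letter :=
  ⟨{.fixed, .valley, .peak, .doubleRise, .doubleFall}, fun s => by cases s <;> decide⟩

namespace Letter

/-- The points with these letters are the excedances: an arc to the right starts there. -/
def opens : Letter → Bool
  | valley | doubleRise => true
  | _ => false

/-- The points with these letters are the values of excedances: an arc to the right ends there. -/
def closes : Letter → Bool
  | peak | doubleRise => true
  | _ => false

/-- The letter of the inverse permutation at the same point. -/
def reverse : Letter → Letter
  | doubleRise => doubleFall
  | doubleFall => doubleRise
  | s => s

/-- The change of height along a letter. -/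
def rise (s : Letter) : ℤ := (if s.opens then 1 else 0) - if s.closes then 1 else 0

theorem ext_iff {s t : Letter} :
    s = t ↔ (s = fixed ↔ t = fixed) ∧ (s.opens ↔ t.opens) ∧ (s.closes ↔ t.closes) := by
  cases s <;> cases t <;> simp [opens, closes]

theorem rise_reverse (s : Letter) : s.reverse.rise = s.rise := by cases s <;> rfl

end Letter

/-- The word of local shapes of a permutation. -/
def word (π : Equiv.Perm (Fin n)) (i : Fin n) : Letter :=
  if π i = i then .fixed
  else if i < π i then if i < π⁻¹ i then .valley else .doubleRise
  else if i < π⁻¹ i then .doubleFall else .peak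

theorem word_eq_fixed_iff : word π i = .fixed ↔ π i = i := by
  unfold word; split_ifs <;> simp_all

theorem opens_word : (word π i).opens = true ↔ i < π i := by
  unfold word; split_ifs <;> simp_all [Letter.opens]

theorem closes_word : (word π i).closes = true ↔ π⁻¹ i < i := by
  have h := inv_apply_eq_iff (π := π) (i := i) (j := i)
  unfold word; split_ifs <;> simp_all [Letter.closes]
  all_goals omega

theorem word_inv : word π⁻¹ = fun i => (word π i).reverse := by
  funext i
  have h := inv_apply_eq_iff (π := π) (i := i) (j := i)
  unfold word
  rw [inv_inv]
  split_ifs <;> simp only [Letter.reverse] <;> omega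

theorem word_eq_word_iff :
    word π i = word σ i ↔ (i < π i ↔ i < σ i) ∧ (π i < i ↔ σ i < i) ∧ (π⁻¹ i < i ↔ σ⁻¹ i < i) := by
  rw [Letter.ext_iff]
  simp only [word_eq_fixed_iff, opens_word, closes_word]
  omega

/-- The height of a word before its position `p`, that is, of the lattice path whose steps are the
rises of the letters. -/
def wordHeight (w : Fin n → Letter) (p : ℕ) : ℤ := ∑ i ∈ {i : Fin n | (i : ℕ) < p}, (w i).rise

/-- The positions where a word opens an arc. -/
def openers (w : Fin n → Letter) : Finset (Fin n) := {i | (w i).opens}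

/-- The positions where a word closes an arc. -/
def closers (w : Fin n → Letter) : Finset (Fin n) := {i | (w i).closes}

theorem mem_openers {w : Fin n → Letter} : i ∈ openers w ↔ (w i).opens = true := mem_filter_univ i

theorem mem_closers {w : Fin n → Letter} : i ∈ closers w ↔ (w i).closes = true := mem_filter_univ i

theorem wordHeight_eq_sub (w : Fin n → Letter) (p : ℕ) :
    wordHeight w p =
      #{i ∈ openers w | Fin.val i < p} - (#{i ∈ closers w | Fin.val i < p} : ℤ) := by
  simp only [wordHeight, Letter.rise, sum_sub_distrib, sum_boole, filter_filter, openers, closers,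
    and_comm]

theorem wordHeight_succ (w : Fin n → Letter) (i : Fin n) :
    wordHeight w (i + 1) = wordHeight w i + (w i).rise := by
  have h : univ.filter (fun k : Fin n => (k : ℕ) < i + 1) =
      insert i (univ.filter fun k => k < i) := by
    ext k
    simp only [mem_insert, mem_filter_univ]
    omega
  rw [wordHeight, h, sum_insert (by simp), add_comm]
  rfl

/-- The number of excedances of `π` that jump over the gap before `p`. -/
def upArcs (π : Equiv.Perm (Fin n)) (p : ℕ) : ℕ := #{i : Fin n | (i : ℕ) < p ∧ p ≤ (π i : ℕ)}

theorem wordHeight_word (π : Equiv.Perm (Fin n)) (p : ℕ) : wordHeight (word π) p = upArcs π p := by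
  have hopen : #{i ∈ openers (word π) | Fin.val i < p} =
      upArcs π p + #{i : Fin n | i < π i ∧ (π i : ℕ) < p} := by
    rw [openers, filter_filter, ← card_filter_add_card_filter_not fun i => p ≤ (π i : ℕ),
      filter_filter, filter_filter, upArcs]
    congr 2 <;> ext i <;> simp only [mem_filter_univ, opens_word] <;> omega
  have hclose : #{i ∈ closers (word π) | Fin.val i < p} =
      #{i : Fin n | i < π i ∧ (π i : ℕ) < p} :=
    (card_equiv π fun i => by simp [closers, closes_word]).symm
  rw [wordHeight_eq_sub, hopen, hclose]
  omega

theorem upArcs_inv (π : Equiv.Perm (Fin n)) (p : ℕ) : upArcs π⁻¹ p = upArcs π p := by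
  rw [← Nat.cast_inj (R := ℤ), ← wordHeight_word, ← wordHeight_word, word_inv]
  simp only [wordHeight, Letter.rise_reverse]

theorem upArcs_pos_iff {p : ℕ} : 0 < upArcs π p ↔ ∃ i : Fin n, (i : ℕ) < p ∧ p ≤ (π i : ℕ) := by
  simp [upArcs, card_pos, Finset.Nonempty]

theorem exists_apply_lt_of_lt_apply {p : ℕ} (hi : (i : ℕ) < p) (hp : p ≤ (π i : ℕ)) :
    ∃ k : Fin n, p ≤ (k : ℕ) ∧ (π k : ℕ) < p := by
  obtain ⟨k, hk, hpk⟩ := upArcs_pos_iff.1 ((upArcs_inv π p).symm ▸ upArcs_pos_iff.2 ⟨i, hi, hp⟩)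
  exact ⟨π⁻¹ k, hpk, by simpa using hk⟩

theorem isNestedFixedPoint_iff : IsNestedFixedPoint π j ↔ π j = j ∧ 0 < upArcs π j := by
  refine and_congr_right fun hj => ⟨?_, fun h => ?_⟩
  · rintro ⟨i, k, hi, hk, h | h⟩
    · exact upArcs_pos_iff.2 ⟨i, hi, h ▸ hk.le⟩
    · rw [← upArcs_inv]
      exact upArcs_pos_iff.2 ⟨i, hi, (inv_apply_eq_iff.2 h).symm ▸ hk.le⟩
  · obtain ⟨i, hi, hji⟩ := upArcs_pos_iff.1 h
    refine ⟨i, π i, hi, lt_of_le_of_ne hji fun h => ?_, Or.inl rfl⟩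
    exact hi.ne (congrArg Fin.val (π.injective (h.symm.trans hj.symm)))

end Words

section Matchings

variable {n : ℕ} {r : Fin n → Fin n → Prop} {π σ : Equiv.Perm (Fin n)} {i j : Fin n}

/-- Taken in the order `r`, each excedance of `π` is matched to the smallest of the values of
excedances that are available to it, namely those to its right that are still free. -/
def GreedyExcedances (r : Fin n → Fin n → Prop) (π : Equiv.Perm (Fin n)) : Prop :=
  ∀ i j, r i j → i < π i → i < π j → j < π j → π i < π j

/-- Read from left to right, the word opens arcs and closes them in the same order. -/
abbrev FirstInFirstOut (π : Equiv.Perm (Fin n)) : Prop := GreedyExcedances (· < ·) π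

/-- Read from left to right, the word opens arcs and each time closes the one opened last. -/
abbrev LastInFirstOut (π : Equiv.Perm (Fin n)) : Prop := GreedyExcedances (· > ·) π

theorem GreedyExcedances.apply_eq [IsWellFounded (Fin n) r] [Std.Trichotomous r]
    (hπ : GreedyExcedances r π) (hσ : GreedyExcedances r σ) (h : word π = word σ) :
    i < π i → π i = σ i := by
  induction i using IsWellFounded.induction r with
  | _ i ih =>
  have not_lt_apply : ∀ {π σ : Equiv.Perm (Fin n)}, GreedyExcedances r σ → word π = word σ →
      i < π i → (∀ k, r k i → k < σ k → π k = σ k) → ¬ π i < σ i := by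
    intro π σ hσ h hi ih hlt
    obtain ⟨k, hk⟩ := σ.surjective (π i)
    have hiσ : i < σ i := hi.trans hlt
    have hkσ : k < σ k := by
      have hclose := (word_eq_word_iff.1 (congrFun h (π i))).2.2.1
      rw [inv_apply_eq_iff.2 rfl, inv_apply_eq_iff.2 hk] at hclose
      exact hk ▸ hclose hi
    rcases trichotomous_of r k i with hki | rfl | hik
    · obtain rfl := π.injective ((ih k hki hkσ).trans hk)
      exact hlt.ne hk.symm
    · exact hlt.ne hk.symm
    · exact (hσ i k hik hiσ (hk ▸ hi) hkσ).not_gt (hk ▸ hlt)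
  have lt_apply_iff (k : Fin n) : k < π k ↔ k < σ k := (word_eq_word_iff.1 (congrFun h k)).1
  intro hi
  refine le_antisymm (not_lt.1 ?_) (not_lt.1 ?_)
  · exact not_lt_apply hπ h.symm ((lt_apply_iff i).1 hi) fun k hk hkπ => (ih k hk hkπ).symm
  · exact not_lt_apply hσ h hi fun k hk hkσ => ih k hk ((lt_apply_iff k).2 hkσ)

theorem injOn_word (r : Fin n → Fin n → Prop) [IsWellFounded (Fin n) r] [Std.Trichotomous r] :
    Set.InjOn word {π : Equiv.Perm (Fin n) | GreedyExcedances r π ∧ GreedyExcedances r π⁻¹} := by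
  rintro π ⟨hπ, hπ'⟩ σ ⟨hσ, hσ'⟩ h
  ext1 i
  rcases lt_trichotomy i (π i) with hi | hi | hi
  · exact hπ.apply_eq hσ h hi
  · rw [← hi, word_eq_fixed_iff.1 ((congrFun h i).symm.trans (word_eq_fixed_iff.2 hi.symm))]
  · have hinv : word π⁻¹ = word σ⁻¹ := by rw [word_inv, word_inv, h]
    have := hπ'.apply_eq hσ' hinv (i := π i) (by simpa using hi)
    rw [inv_apply_eq_iff.2 rfl] at this
    exact (inv_apply_eq_iff.1 this.symm).symm

theorem Avoids321.inv (h : Avoids321 π) : Avoids321 π⁻¹ := by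
  rintro ⟨i, j, k, hij, hjk, hkj, hji⟩
  exact h ⟨π⁻¹ k, π⁻¹ j, π⁻¹ i, hkj, hji, by simpa, by simpa⟩

theorem Avoids321.firstInFirstOut (h : Avoids321 π) : FirstInFirstOut π := by
  intro i j hij _ _ hj
  by_contra hle
  have hlt : π j < π i := (not_lt.1 hle).lt_of_ne fun heq => hij.ne' (π.injective heq)
  obtain ⟨k, hk, hkj⟩ := exists_apply_lt_of_lt_apply (π := π) (p := j + 1) j.val.lt_succ_self hj
  exact h ⟨i, j, k, hij, hk, (Nat.lt_succ_iff.1 hkj).trans_lt hj, hlt⟩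

theorem Avoids321.not_isNestedFixedPoint (h : Avoids321 π) : ¬ IsNestedFixedPoint π j := by
  intro hj
  obtain ⟨hfix, hpos⟩ := isNestedFixedPoint_iff.1 hj
  obtain ⟨i, hi, hij⟩ := upArcs_pos_iff.1 hpos
  obtain ⟨k, hjk, hk⟩ := exists_apply_lt_of_lt_apply hi hij
  have hne : π i ≠ π j := fun h => by have := π.injective h; omega
  have hne' : k ≠ j := by rintro rfl; omega
  exact h ⟨i, j, k, hi, by omega, by omega, by omega⟩

theorem avoids321_iff :
    Avoids321 π ↔ FirstInFirstOut π ∧ FirstInFirstOut π⁻¹ ∧ ∀ j, ¬ IsNestedFixedPoint π j := by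
  refine ⟨fun h => ⟨h.firstInFirstOut, h.inv.firstInFirstOut,
    fun j => h.not_isNestedFixedPoint⟩, ?_⟩
  rintro ⟨hπ, hinv, hnested⟩ ⟨i, j, k, hij, hjk, hkj, hji⟩
  rcases lt_trichotomy (π j) j with hj | hj | hj
  · have := hinv (π k) (π j) hkj (by simp; omega) (by simp; omega) (by simpa using hj)
    simp at this
    omega
  · exact hnested j ⟨hj, i, π i, hij, hj ▸ hji, Or.inl rfl⟩
  · have := hπ i j hij (by omega) (by omega) hj
    omega

theorem mem_avoiding321_iff : π ∈ avoiding321 n ↔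
    FirstInFirstOut π ∧ FirstInFirstOut π⁻¹ ∧ ∀ j, ¬ IsNestedFixedPoint π j := by
  classical
  rw [← avoids321_iff]
  exact mem_filter_univ π

theorem word_mul_swap (hij : i < j) (hi : j < π i) (hj : j < π j) :
    word (π * Equiv.swap i j) = word π := by
  funext k
  have happly : (π * Equiv.swap i j) k = if k = i then π j else if k = j then π i else π k := by
    rw [Equiv.Perm.mul_apply, Equiv.swap_apply_def]
    split_ifs <;> rfl
  have hinv : (π * Equiv.swap i j)⁻¹ k =
      if k = π i then j else if k = π j then i else π⁻¹ k := by
    rw [mul_inv_rev, Equiv.swap_inv, Equiv.Perm.mul_apply, Equiv.swap_apply_def]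
    simp only [inv_apply_eq_iff, eq_comm (a := k)]
  have hπi : π⁻¹ (π i) = i := inv_apply_eq_iff.2 rfl
  have hπj : π⁻¹ (π j) = j := inv_apply_eq_iff.2 rfl
  rw [word_eq_word_iff, happly, hinv]
  refine ⟨?_, ?_, ?_⟩ <;> split_ifs <;> subst_vars <;> omega

theorem sum_mul_inv_apply (π : Equiv.Perm (Fin n)) :
    ∑ k : Fin n, (k : ℤ) * (π⁻¹ k : ℕ) = ∑ k : Fin n, (k : ℤ) * (π k : ℕ) := by
  rw [← Equiv.sum_comp π fun k : Fin n => (k : ℤ) * (π⁻¹ k : ℕ)]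
  exact sum_congr rfl fun k _ => by rw [inv_apply_eq_iff.2 rfl, mul_comm]

theorem lastInFirstOut_of_forall_sum_le
    (h : ∀ σ, word σ = word π →
      ∑ k : Fin n, (k : ℤ) * (π k : ℕ) ≤ ∑ k : Fin n, (k : ℤ) * (σ k : ℕ)) :
    LastInFirstOut π := by
  intro j i hij hj hji _
  refine (not_lt.1 fun hlt => ?_).lt_of_ne fun heq => hij.ne' (π.injective heq)
  refine (h _ (word_mul_swap hij hji hj)).not_gt ?_
  exact sum_mul_comp_swap_lt (f := fun k : Fin n => (k : ℤ)) (g := fun k => ((π k : ℕ) : ℤ))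
    (by exact_mod_cast hij) (by exact_mod_cast hlt)

/-- By the rearrangement inequality, repairing a violation of the last in, first out rule decreases
`∑ k * π k`, so a minimizer has none left. The sum is the same for `π⁻¹`. -/
theorem exists_lastInFirstOut (σ : Equiv.Perm (Fin n)) :
    ∃ π : Equiv.Perm (Fin n), word π = word σ ∧ LastInFirstOut π ∧ LastInFirstOut π⁻¹ := by
  obtain ⟨π, hπ, hmin⟩ := exists_min_image {π | word π = word σ}
    (fun π : Equiv.Perm (Fin n) => ∑ k : Fin n, (k : ℤ) * (π k : ℕ)) ⟨σ, by simp⟩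
  simp only [mem_filter, mem_univ, true_and] at hπ hmin
  refine ⟨π, hπ, lastInFirstOut_of_forall_sum_le fun τ hτ => hmin τ (hτ.trans hπ),
    lastInFirstOut_of_forall_sum_le fun τ hτ => ?_⟩
  have hinv : word τ⁻¹ = word σ := by rw [word_inv, hτ, ← word_inv, inv_inv, hπ]
  rw [sum_mul_inv_apply, ← sum_mul_inv_apply τ]
  exact hmin _ hinv

end Matchings

section Cycles

theorem exists_pow_eq_of_sameCycle {α : Type*} [Finite α] {π : Equiv.Perm α} {a i : α}
    (h : π.SameCycle a i) : ∃ s < Function.minimalPeriod π a, (π ^ s) a = i := by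
  obtain ⟨s, rfl⟩ := h.exists_nat_pow_eq
  refine ⟨s % Function.minimalPeriod π a, Nat.mod_lt _ ?_, ?_⟩
  · exact Function.minimalPeriod_pos_of_mem_periodicPts (π.injective.mem_periodicPts a)
  · simp only [← Equiv.Perm.iterate_eq_pow, Function.iterate_mod_minimalPeriod_eq]

theorem pow_apply_injOn_Iio_minimalPeriod {α : Type*} (π : Equiv.Perm α) (a : α) :
    (Set.Iio (Function.minimalPeriod π a)).InjOn fun s => (π ^ s) a := by
  simpa only [Equiv.Perm.iterate_eq_pow] using
    Function.iterate_injOn_Iio_minimalPeriod (f := π) (x := a)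

theorem exists_sameCycle_forall_le {α : Type*} [Finite α] [LinearOrder α] (π : Equiv.Perm α)
    (i : α) : ∃ a, π.SameCycle a i ∧ ∀ b, π.SameCycle a b → a ≤ b := by
  obtain ⟨a, ha, hmin⟩ := Set.exists_min_image {a | π.SameCycle a i} id (Set.toFinite _)
    ⟨i, Equiv.Perm.SameCycle.refl π i⟩
  exact ⟨a, ha, fun b hb => hmin b (hb.symm.trans ha)⟩

variable {n : ℕ} {π : Equiv.Perm (Fin n)} {a i j k : Fin n}

/-- The point `i` is a strict local minimum of its cycle. -/
def IsValley (π : Equiv.Perm (Fin n)) (i : Fin n) : Prop := i < π i ∧ i < π⁻¹ i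

theorem isValley_of_forall_le (hmin : ∀ b, π.SameCycle a b → a ≤ b) (ha : π a ≠ a) :
    IsValley π a :=
  ⟨(hmin _ ⟨1, by simp⟩).lt_of_ne ha.symm, (hmin _ ⟨-1, by simp⟩).lt_of_ne fun h =>
    ha (inv_apply_eq_iff.1 h.symm)⟩

theorem exists_sameCycle_isValley (hi : π i ≠ i) : ∃ a, π.SameCycle a i ∧ IsValley π a := by
  obtain ⟨a, ha, hmin⟩ := exists_sameCycle_forall_le π i
  exact ⟨a, ha, isValley_of_forall_le hmin fun hfix => hi ((ha.eq_of_left hfix) ▸ hfix)⟩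

/-- Every cycle has at most one strict local minimum. -/
def UniqueValleys (π : Equiv.Perm (Fin n)) : Prop :=
  ∀ i j, π.SameCycle i j → IsValley π i → IsValley π j → i = j

theorem UniqueValleys.inv (h : UniqueValleys π) : UniqueValleys π⁻¹ := fun i j hij hi hj =>
  h i j (Equiv.Perm.sameCycle_inv.1 hij) ⟨by simpa using hi.2, hi.1⟩ ⟨by simpa using hj.2, hj.1⟩

theorem UnimodalFrom.exists_ascents (h : UnimodalFrom π a)
    (hmin : ∀ b, π.SameCycle a b → a ≤ b) :
    ∃ m, StrictMonoOn (fun s => (π ^ s) a) (Set.Iic m) ∧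
      ∀ i, π.SameCycle a i → i < π i → ∃ s < m, (π ^ s) a = i := by
  obtain ⟨m, _, hinc, hdec⟩ := h
  refine ⟨m, strictMonoOn_Iic_of_lt_succ hinc, fun i hi hlt => ?_⟩
  obtain ⟨s, hs, rfl⟩ := exists_pow_eq_of_sameCycle hi
  rw [← Equiv.Perm.mul_apply, ← pow_succ'] at hlt
  refine ⟨s, not_le.1 fun hms => ?_, rfl⟩
  rcases (Nat.succ_le_of_lt hs).lt_or_eq with hs' | hs'
  · exact (hdec s hms hs').not_gt hlt
  · have hturn : (π ^ (s + 1)) a = a := by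
      rw [← Equiv.Perm.iterate_eq_pow, ← Nat.succ_eq_add_one, hs', Function.iterate_minimalPeriod]
    exact (hmin _ hi).not_gt (hlt.trans_eq hturn)

theorem UnimodalFrom.eq_of_isValley (h : UnimodalFrom π a) (hmin : ∀ b, π.SameCycle a b → a ≤ b)
    (hi : π.SameCycle a i) (hv : IsValley π i) : i = a := by
  obtain ⟨m, hmono, hascent⟩ := h.exists_ascents hmin
  obtain ⟨s, hs, rfl⟩ := hascent i hi hv.1
  cases s with
  | zero => rfl
  | succ s =>
    have hpred : π⁻¹ ((π ^ (s + 1)) a) = (π ^ s) a := by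
      rw [inv_apply_eq_iff, pow_succ', Equiv.Perm.mul_apply]
    have hlt : (π ^ s) a < (π ^ (s + 1)) a := hmono (by simp; omega) hs.le s.lt_succ_self
    exact absurd (hpred ▸ hv.2) hlt.not_gt

theorem UniqueValleys.unimodalFrom (h : UniqueValleys π) (hmin : ∀ b, π.SameCycle a b → a ≤ b) :
    UnimodalFrom π a := by
  have hinj := pow_apply_injOn_Iio_minimalPeriod π a
  refine exists_unimodal_index
    (Function.minimalPeriod_pos_of_mem_periodicPts (π.injective.mem_periodicPts a))
    (fun s hs => hinj.ne (Nat.lt_of_succ_lt hs) hs s.succ_ne_self.symm) fun s hs hdown hup => ?_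
  have hv : IsValley π ((π ^ (s + 1)) a) := by
    refine ⟨by rwa [← Equiv.Perm.mul_apply, ← pow_succ'], ?_⟩
    rwa [pow_succ', Equiv.Perm.mul_apply, inv_apply_eq_iff.2 rfl, ← Equiv.Perm.mul_apply,
      ← pow_succ']
  have ha : π a ≠ a := fun ha => hinj.ne (Nat.zero_lt_of_lt hs)
    ((Nat.one_lt_succ_succ s).trans hs) zero_ne_one (by simp [ha])
  refine hinj.ne (Nat.zero_lt_of_lt hs) (Nat.lt_of_succ_lt hs) (Nat.succ_ne_zero s).symm ?_
  exact h a _ (Equiv.Perm.sameCycle_pow_right.2 (.refl π a)) (isValley_of_forall_le hmin ha) hv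

theorem unimodalCycles_iff : UnimodalCycles π ↔ UniqueValleys π := by
  refine ⟨fun h i j hij hi hj => ?_, fun h a hmin => h.unimodalFrom hmin⟩
  obtain ⟨a, ha, hmin⟩ := exists_sameCycle_forall_le π i
  rw [(h a hmin).eq_of_isValley hmin ha hi, (h a hmin).eq_of_isValley hmin (ha.trans hij) hj]

theorem NoncrossingCycles.inv (h : NoncrossingCycles π) : NoncrossingCycles π⁻¹ := by
  simpa only [NoncrossingCycles, Equiv.Perm.sameCycle_inv] using h

theorem NoncrossingCycles.lastInFirstOut (h : NoncrossingCycles π) (hu : UnimodalCycles π) :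
    LastInFirstOut π := by
  intro j i hij hj hji hi
  by_contra hle
  have hlt : π i < π j := (not_lt.1 hle).lt_of_ne fun heq => hij.ne (π.injective heq)
  have hsame : π.SameCycle i j := by
    by_contra hne
    exact h ⟨i, j, π i, π j, hij, hji, hlt, ⟨1, by simp⟩, ⟨1, by simp⟩, hne⟩
  obtain ⟨a, ha, hmin⟩ := exists_sameCycle_forall_le π i
  obtain ⟨m, hmono, hascent⟩ := (hu a hmin).exists_ascents hmin
  obtain ⟨s, hs, rfl⟩ := hascent i ha hi
  obtain ⟨t, ht, rfl⟩ := hascent j (ha.trans hsame) hj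
  have hst : s < t := (hmono.lt_iff_lt hs.le ht.le).1 hij
  refine (hmono.le_iff_le (show s + 1 ≤ m from hs) ht.le).2 hst |>.not_gt ?_
  simpa only [pow_succ', Equiv.Perm.mul_apply] using hji

theorem upArcs_succ (π : Equiv.Perm (Fin n)) (i : Fin n) :
    upArcs π (i + 1) + (if π⁻¹ i < i then 1 else 0) = upArcs π i + if i < π i then 1 else 0 := by
  have h := wordHeight_succ (word π) i
  simp only [wordHeight_word, Letter.rise, opens_word, closes_word] at h
  split_ifs at h ⊢ <;> omega

/-- The height of the word of `π` at `i`: the larger of the heights of the two adjacent gaps. -/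
def level (π : Equiv.Perm (Fin n)) (i : Fin n) : ℕ := max (upArcs π i) (upArcs π (i + 1))

theorem upArcs_le_level : upArcs π i ≤ level π i := le_max_left _ _

theorem level_of_lt_apply (hi : i < π i) : level π i = upArcs π (i + 1) := by
  have h := upArcs_succ π i
  rw [if_pos hi] at h
  exact max_eq_right (by split_ifs at h <;> omega)

theorem level_of_inv_apply_lt (hi : π⁻¹ i < i) : level π i = upArcs π i := by
  have h := upArcs_succ π i
  rw [if_pos hi] at h
  exact max_eq_left (by split_ifs at h <;> omega)

theorem IsValley.upArcs_lt_level (hi : IsValley π i) : upArcs π i < level π i := by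
  have h := upArcs_succ π i
  rw [if_pos hi.1, if_neg hi.2.not_gt] at h
  rw [level_of_lt_apply hi.1]
  omega

/-- The points `i` and `j` are at the same level, and the height does not drop below that level
between them. If `π` and its inverse are last in, first out, this means, fixed points aside, that
`i` and `j` belong to the same cycle. -/
def Linked (π : Equiv.Perm (Fin n)) (i j : Fin n) : Prop :=
  level π i = level π j ∧
    ∀ p : ℕ, ((i : ℕ) < p ∧ p ≤ j) ∨ ((j : ℕ) < p ∧ p ≤ i) → level π i ≤ upArcs π p

theorem Linked.refl (π : Equiv.Perm (Fin n)) (i : Fin n) : Linked π i i :=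
  ⟨rfl, fun p hp => by omega⟩

theorem Linked.symm (h : Linked π i j) : Linked π j i :=
  ⟨h.1.symm, fun p hp => h.1 ▸ h.2 p hp.symm⟩

theorem Linked.trans (hij : Linked π i j) (hjk : Linked π j k) : Linked π i k := by
  refine ⟨hij.1.trans hjk.1, fun p hp => ?_⟩
  by_cases hpij : ((i : ℕ) < p ∧ p ≤ j) ∨ ((j : ℕ) < p ∧ p ≤ i)
  · exact hij.2 p hpij
  · exact hij.1 ▸ hjk.2 p (by omega)

theorem linked_inv : Linked π⁻¹ i j ↔ Linked π i j := by
  simp only [Linked, level, upArcs_inv]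

theorem LastInFirstOut.linked (h : LastInFirstOut π) (hi : i < π i) : Linked π i (π i) := by
  have hclose : π⁻¹ (π i) < π i := by rwa [inv_apply_eq_iff.2 rfl]
  have hle : ∀ p : ℕ, i < p → p ≤ π i → upArcs π (i + 1) ≤ upArcs π p := by
    refine fun p hp hpi => card_le_card fun k hk => ?_
    simp only [mem_filter_univ] at hk ⊢
    rcases lt_or_eq_of_le (show k ≤ i by omega) with hki | rfl
    · have := h i k hki hi (by omega) (by omega)
      omega
    · omega
  have hge : upArcs π (π i) ≤ upArcs π (i + 1) := by
    refine card_le_card fun k hk => ?_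
    simp only [mem_filter_univ] at hk ⊢
    have : ¬ i < k := fun hik => by
      have := h k i hik (by omega) (by omega) hi
      omega
    omega
  rw [Linked, level_of_lt_apply hi, level_of_inv_apply_lt hclose]
  exact ⟨(hle _ hi le_rfl).antisymm hge, fun p hp => hle p (by omega) (by omega)⟩

theorem LastInFirstOut.linked_of_sameCycle (h : LastInFirstOut π) (hinv : LastInFirstOut π⁻¹)
    (hij : π.SameCycle i j) : Linked π i j := by
  have hstep : ∀ k, Linked π k (π k) := by
    intro k
    rcases lt_trichotomy k (π k) with hk | hk | hk
    · exact h.linked hk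
    · exact hk ▸ .refl π k
    · have := hinv.linked (i := π k) (by rwa [inv_apply_eq_iff.2 rfl])
      rw [inv_apply_eq_iff.2 rfl, linked_inv] at this
      exact this.symm
  obtain ⟨s, rfl⟩ := hij.exists_nat_pow_eq
  clear hij
  induction s with
  | zero => exact .refl π i
  | succ s ih =>
    rw [pow_succ', Equiv.Perm.mul_apply]
    exact ih.trans (hstep _)

theorem Linked.eq_of_isValley (h : Linked π i j) (hi : IsValley π i) (hj : IsValley π j) :
    i = j := by
  have not_lt_of_isValley : ∀ {i j : Fin n}, Linked π i j → IsValley π j → ¬ i < j :=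
    fun h hj hlt => (h.1 ▸ h.2 _ (Or.inl ⟨hlt, le_rfl⟩)).not_gt hj.upArcs_lt_level
  exact le_antisymm (not_lt.1 (not_lt_of_isValley h.symm hi)) (not_lt.1 (not_lt_of_isValley h hj))

theorem LastInFirstOut.uniqueValleys (h : LastInFirstOut π) (hinv : LastInFirstOut π⁻¹) :
    UniqueValleys π :=
  fun _ _ hij hi hj => (h.linked_of_sameCycle hinv hij).eq_of_isValley hi hj

theorem LastInFirstOut.sameCycle_of_linked (h : LastInFirstOut π) (hinv : LastInFirstOut π⁻¹)
    (hij : Linked π i j) (hi : π i ≠ i) (hj : π j ≠ j) : π.SameCycle i j := by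
  obtain ⟨a, ha, hva⟩ := exists_sameCycle_isValley hi
  obtain ⟨b, hb, hvb⟩ := exists_sameCycle_isValley hj
  have hab : Linked π a b :=
    ((h.linked_of_sameCycle hinv ha).trans hij).trans (h.linked_of_sameCycle hinv hb).symm
  obtain rfl := hab.eq_of_isValley hva hvb
  exact ha.symm.trans hb

theorem LastInFirstOut.noncrossingCycles (h : LastInFirstOut π) (hinv : LastInFirstOut π⁻¹) :
    NoncrossingCycles π := by
  rintro ⟨i, j, k, l, hij, hjk, hkl, hik, hjl, hne⟩
  have hlink := h.linked_of_sameCycle hinv hik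
  have hlink' := h.linked_of_sameCycle hinv hjl
  have hi : π i ≠ i := fun hfix => (hij.trans hjk).ne (hik.eq_of_left hfix)
  have hj : π j ≠ j := fun hfix => (hjk.trans hkl).ne (hjl.eq_of_left hfix)
  have hle : level π i ≤ level π j :=
    (hlink.2 j (by omega)).trans upArcs_le_level
  have hge : level π j ≤ level π i :=
    ((hlink'.2 k (by omega)).trans upArcs_le_level).trans hlink.1.ge
  exact hne (h.sameCycle_of_linked hinv ⟨hle.antisymm hge, fun p hp => hlink.2 p (by omega)⟩ hi hj)

theorem mem_unimodalNoncrossing_iff : π ∈ unimodalNoncrossing n ↔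
    LastInFirstOut π ∧ LastInFirstOut π⁻¹ ∧ ∀ j, ¬ IsNestedFixedPoint π j := by
  classical
  refine (mem_filter_univ π).trans ⟨fun ⟨huni, hnc, hfix⟩ => ?_, fun ⟨h, hinv, hfix⟩ => ?_⟩
  · have hvalleys := unimodalCycles_iff.1 huni
    exact ⟨hnc.lastInFirstOut huni,
      hnc.inv.lastInFirstOut (unimodalCycles_iff.2 hvalleys.inv), hfix⟩
  · exact ⟨unimodalCycles_iff.2 (h.uniqueValleys hinv), h.noncrossingCycles hinv, hfix⟩

end Cycles

section ValidWords

variable {n : ℕ} {w : Fin n → Letter} {π : Equiv.Perm (Fin n)} {i : Fin n}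

/-- The letter is allowed at the height `h`: points on the axis are fixed or valleys, points above
it are not fixed. -/
def Letter.Fits (h : ℤ) : Letter → Prop
  | fixed => h = 0
  | valley => 0 ≤ h
  | _ => 1 ≤ h

instance (h : ℤ) : DecidablePred (Letter.Fits h) := fun s => by
  cases s <;> unfold Letter.Fits <;> infer_instance

/-- Words that describe a labelled Motzkin path from height `h` down to height zero: every letter
is allowed at its height. -/
def IsMotzkinFrom (h : ℤ) (w : Fin n → Letter) : Prop :=
  (∀ i : Fin n, (w i).Fits (h + wordHeight w i)) ∧ h + wordHeight w n = 0

instance (h : ℤ) : DecidablePred (IsMotzkinFrom (n := n) h) := fun _ => instDecidableAnd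

theorem fits_word (hi : π i ≠ i) : (word π i).Fits (upArcs π i) := by
  have hdown : π i < i → 0 < upArcs π i := fun h => by
    rw [← upArcs_inv]
    exact upArcs_pos_iff.2 ⟨π i, h, (inv_apply_eq_iff.2 rfl).ge⟩
  have hup : π⁻¹ i < i → 0 < upArcs π i := fun h =>
    upArcs_pos_iff.2 ⟨π⁻¹ i, h, (inv_apply_eq_iff.1 rfl).ge⟩
  have hfixed := (word_eq_fixed_iff (π := π) (i := i)).not.2 hi
  have hopens := (opens_word (π := π) (i := i)).not
  have hcloses := closes_word (π := π) (i := i)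
  cases hw : word π i <;> simp [hw, Letter.Fits, Letter.opens, Letter.closes] at * <;> omega

theorem isMotzkinFrom_zero_word_iff :
    IsMotzkinFrom 0 (word π) ↔ ∀ j, ¬ IsNestedFixedPoint π j := by
  have hend : upArcs π n = 0 := card_eq_zero.2 (filter_false_of_mem fun i _ => by omega)
  simp only [IsMotzkinFrom, wordHeight_word, zero_add, hend, Nat.cast_zero, and_true,
    isNestedFixedPoint_iff, not_and, Nat.pos_iff_ne_zero, not_not]
  refine forall_congr' fun i => ⟨fun h hi => ?_, fun h => ?_⟩
  · rw [word_eq_fixed_iff.2 hi] at h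
    exact Nat.cast_eq_zero.1 h
  · by_cases hi : π i = i
    · rw [word_eq_fixed_iff.2 hi, h hi]
      rfl
    · exact fits_word hi

theorem card_openers_eq_card_closers (h : wordHeight w n = 0) : #(openers w) = #(closers w) := by
  rw [wordHeight_eq_sub] at h
  simp only [Fin.is_lt, filter_true] at h
  omega

theorem card_filter_le_eq {α : Type*} [LinearOrder α] (B : Finset α) (i : α) :
    #{b ∈ B | b ≤ i} = #{b ∈ B | b < i} + if i ∈ B then 1 else 0 := by
  simp only [le_iff_lt_or_eq, filter_or]
  rw [card_union_of_disjoint (disjoint_filter.2 fun _ _ h => h.ne), filter_eq']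
  split_ifs <;> rfl

theorem card_filter_add_card_filter_compl {α : Type*} [Fintype α] [DecidableEq α] (A : Finset α)
    (p : α → Prop) [DecidablePred p] : #{a ∈ A | p a} + #{a ∈ Aᶜ | p a} = #{a | p a} := by
  rw [← card_union_of_disjoint (disjoint_filter_filter disjoint_compl_right), ← filter_union,
    union_compl]

theorem IsMotzkinFrom.lt_apply (hw : IsMotzkinFrom 0 w) (hπ : ∀ i, π i ∈ closers w ↔ i ∈ openers w)
    (hmono : StrictMonoOn π (openers w)) (hi : i ∈ openers w) : i < π i := by
  have hfits := hw.1 i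
  rw [wordHeight_eq_sub, zero_add] at hfits
  rw [lt_perm_apply_iff hπ hmono hi, card_filter_le_eq]
  rw [mem_openers] at hi
  simp only [mem_closers]
  cases hs : w i <;> simp [hs, Letter.Fits, Letter.opens, Letter.closes] at hi hfits ⊢ <;> omega

theorem IsMotzkinFrom.apply_le (hw : IsMotzkinFrom 0 w)
    (hπ : ∀ i, π i ∈ closers w ↔ i ∈ openers w) (hmono : StrictMonoOn π ↑(openers w)ᶜ)
    (hi : i ∉ openers w) : π i ≤ i ∧ (π i < i ↔ w i ≠ .fixed) := by
  have hfits := hw.1 i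
  have hπ' : ∀ i, π i ∈ (closers w)ᶜ ↔ i ∈ (openers w)ᶜ := by simp [hπ]
  rw [wordHeight_eq_sub, zero_add] at hfits
  have hA := card_filter_add_card_filter_compl (openers w) (· < i)
  have hB := card_filter_add_card_filter_compl (closers w) (· < i)
  rw [← not_lt, lt_perm_apply_iff hπ' hmono (mem_compl.2 hi),
    perm_apply_lt_iff hπ' hmono (mem_compl.2 hi), card_filter_le_eq]
  rw [mem_openers] at hi
  simp only [mem_compl, mem_closers]
  cases hs : w i <;> simp [hs, Letter.Fits, Letter.opens, Letter.closes] at hi hfits ⊢ <;> omega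

theorem IsMotzkinFrom.exists_firstInFirstOut (hw : IsMotzkinFrom 0 w) :
    ∃ π : Equiv.Perm (Fin n), word π = w ∧ FirstInFirstOut π ∧ FirstInFirstOut π⁻¹ := by
  have hend : wordHeight w n = 0 := (zero_add _).symm.trans hw.2
  obtain ⟨π, hπ, hmono, hmono'⟩ :=
    exists_perm_strictMonoOn (card_openers_eq_card_closers hend)
  have hopen (i : Fin n) : i < π i ↔ i ∈ openers w :=
    ⟨fun h => not_not.1 fun hi => (hw.apply_le hπ hmono' hi).1.not_gt h, hw.lt_apply hπ hmono⟩
  have hfixed (i : Fin n) : π i = i ↔ w i = .fixed := by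
    by_cases hi : i ∈ openers w
    · have hlt := (hopen i).2 hi
      have hne : w i ≠ .fixed := fun h => by simp [mem_openers, h, Letter.opens] at hi
      simp [hlt.ne', hne]
    · have hle := hw.apply_le hπ hmono' hi
      rw [← not_iff_not, ← ne_eq (w i), ← hle.2, lt_iff_le_and_ne, and_iff_right hle.1]
  have hclose (i : Fin n) : π⁻¹ i < i ↔ i ∈ closers w := by
    have h := hopen (π⁻¹ i)
    rwa [← hπ, inv_apply_eq_iff.1 rfl] at h
  have hmem {k : Fin n} (hk : k < π⁻¹ k) : π⁻¹ k ∈ ((openers w)ᶜ : Finset (Fin n)) :=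
    mem_compl.2 fun h => hk.not_gt ((hopen _).2 h |>.trans_eq (inv_apply_eq_iff.1 rfl))
  refine ⟨π, ?_, fun i j hij hi _ hj => ?_, fun i j hij hi _ hj => ?_⟩
  · funext i
    rw [Letter.ext_iff, word_eq_fixed_iff, opens_word, closes_word, hfixed, hopen, hclose,
      mem_openers, mem_closers]
    exact ⟨Iff.rfl, Iff.rfl, Iff.rfl⟩
  · exact hmono ((hopen i).1 hi) ((hopen j).1 hj) hij
  · rw [← hmono'.lt_iff_lt (hmem hi) (hmem hj)]
    simpa using hij

theorem bijOn_word_unimodalNoncrossing (n : ℕ) :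
    Set.BijOn word (unimodalNoncrossing n) {w : Fin n → Letter | IsMotzkinFrom 0 w} := by
  refine ⟨fun π hπ => ?_, fun π hπ σ hσ h => ?_, fun w hw => ?_⟩
  · exact isMotzkinFrom_zero_word_iff.2 (mem_unimodalNoncrossing_iff.1 hπ).2.2
  · have hπ' := mem_unimodalNoncrossing_iff.1 hπ
    have hσ' := mem_unimodalNoncrossing_iff.1 hσ
    exact injOn_word (· > ·) ⟨hπ'.1, hπ'.2.1⟩ ⟨hσ'.1, hσ'.2.1⟩ h
  · obtain ⟨σ, rfl, -⟩ := IsMotzkinFrom.exists_firstInFirstOut hw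
    obtain ⟨π, hπ, hlast⟩ := exists_lastInFirstOut σ
    refine ⟨π, mem_unimodalNoncrossing_iff.2 ⟨hlast.1, hlast.2, ?_⟩, hπ⟩
    exact isMotzkinFrom_zero_word_iff.1 (hπ ▸ hw)

theorem bijOn_word_avoiding321 (n : ℕ) :
    Set.BijOn word (avoiding321 n) {w : Fin n → Letter | IsMotzkinFrom 0 w} := by
  refine ⟨fun π hπ => ?_, fun π hπ σ hσ h => ?_, fun w hw => ?_⟩
  · exact isMotzkinFrom_zero_word_iff.2 (mem_avoiding321_iff.1 hπ).2.2
  · have hπ' := mem_avoiding321_iff.1 hπ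
    have hσ' := mem_avoiding321_iff.1 hσ
    exact injOn_word (· < ·) ⟨hπ'.1, hπ'.2.1⟩ ⟨hσ'.1, hσ'.2.1⟩ h
  · obtain ⟨π, rfl, hfirst⟩ := IsMotzkinFrom.exists_firstInFirstOut hw
    refine ⟨π, mem_avoiding321_iff.2 ⟨hfirst.1, hfirst.2, ?_⟩, rfl⟩
    exact isMotzkinFrom_zero_word_iff.1 hw

theorem sum_comp_word {M : Type*} [AddCommMonoid M] {s : Finset (Equiv.Perm (Fin n))}
    (hs : Set.BijOn word s {w : Fin n → Letter | IsMotzkinFrom 0 w}) (f : (Fin n → Letter) → M) :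
    ∑ π ∈ s, f (word π) = ∑ w with IsMotzkinFrom 0 w, f w :=
  sum_nbij word (fun _ hπ => (mem_filter_univ _).2 (hs.mapsTo hπ)) hs.injOn
    (by simpa using hs.surjOn) fun _ _ => rfl

theorem card_filter_word_eq (n : ℕ) (P : (Fin n → Letter) → Prop) [DecidablePred P] :
    #{π ∈ unimodalNoncrossing n | P (word π)} = #{π ∈ avoiding321 n | P (word π)} := by
  rw [card_filter, card_filter,
    sum_comp_word (bijOn_word_unimodalNoncrossing n) fun w => if P w then 1 else 0,
    sum_comp_word (bijOn_word_avoiding321 n) fun w => if P w then 1 else 0]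

end ValidWords

section Statistics

variable {n : ℕ} {π : Equiv.Perm (Fin n)} {i : Fin n}

theorem word_eq_valley_iff : word π i = .valley ↔ IsValley π i := by
  unfold word IsValley; split_ifs <;> simp_all

theorem word_eq_doubleRise_iff : word π i = .doubleRise ↔ π⁻¹ i < i ∧ i < π i := by
  have h := inv_apply_eq_iff (π := π) (i := i) (j := i)
  unfold word; split_ifs <;> simp_all
  all_goals omega

theorem fp_eq_card_word (π : Equiv.Perm (Fin n)) : fp π = #{i | word π i = .fixed} := by
  simp only [fp, word_eq_fixed_iff]

theorem exc_eq_card_word (π : Equiv.Perm (Fin n)) : exc π = #{i | (word π i).opens} := by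
  simp only [exc, opens_word]

theorem dexc_eq_card_word (π : Equiv.Perm (Fin n)) : dexc π = #{i | word π i = .doubleRise} := by
  refine card_equiv π fun i => ?_
  rw [mem_filter_univ, mem_filter_univ, word_eq_doubleRise_iff, inv_apply_eq_iff.2 rfl]

theorem cyc_eq_card_word (h : UniqueValleys π) :
    cyc π = #{i | word π i = .fixed ∨ word π i = .valley} := by
  rw [cyc, ← Fintype.card_subtype, ← Nat.card_eq_fintype_card]
  refine (Nat.card_eq_of_bijective
    (fun i => Quotient.mk (Equiv.Perm.SameCycle.setoid π) i.1) ⟨?_, fun c => ?_⟩).symm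
  · rintro ⟨i, hi⟩ ⟨j, hj⟩ hij
    have hsame : π.SameCycle i j := Quotient.exact hij
    rw [word_eq_fixed_iff, word_eq_valley_iff] at hi hj
    refine Subtype.ext ?_
    rcases hi with hi | hi
    · exact hsame.eq_of_left hi
    · rcases hj with hj | hj
      · exact hsame.eq_of_right hj
      · exact h i j hsame hi hj
  · obtain ⟨i, rfl⟩ := Quotient.exists_rep c
    by_cases hfix : π i = i
    · exact ⟨⟨i, Or.inl (word_eq_fixed_iff.2 hfix)⟩, rfl⟩
    · obtain ⟨a, ha, hvalley⟩ := exists_sameCycle_isValley hfix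
      exact ⟨⟨a, Or.inr (word_eq_valley_iff.2 hvalley)⟩, Quotient.sound ha⟩

theorem card_arcs_over_add (π : Equiv.Perm (Fin n)) (k : Fin n) :
    #{i | i < k ∧ k < π i} + (if π⁻¹ k < k then 1 else 0) = upArcs π k := by
  have h : (if π⁻¹ k < k then 1 else 0) = ∑ i, if π i = k ∧ i < k then 1 else 0 := by
    simp only [ite_and, ← inv_apply_eq_iff (π := π) (i := k), sum_ite_eq, mem_univ, if_true]
  rw [h, upArcs, card_filter, card_filter, ← sum_add_distrib]
  refine sum_congr rfl fun i _ => ?_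
  split_ifs <;> omega

theorem card_arcs_under_add (π : Equiv.Perm (Fin n)) (k : Fin n) :
    #{i | π i < k ∧ k < i} + (if π k < k then 1 else 0) = upArcs π k := by
  rw [← upArcs_inv, ← card_arcs_over_add, inv_inv]
  congr 1
  exact card_equiv π fun i => by simp

theorem sum_ite_and {α : Type*} [Fintype α] (p : Prop) [Decidable p] (r : α → Prop)
    [DecidablePred r] : ∑ i, (if p ∧ r i then 1 else 0) = if p then #{i | r i} else 0 := by
  split_ifs with hp <;> simp [hp]

/-- The four kinds of inversions: an arc to the right nested over another one, an arc to the left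
jumping over a point `i` with `π i < i`, an arc to the left jumping over an excedance, and an arc to
the left whose left end is the start of an arc to the right or is jumped over by one. -/
theorem ite_inversion_eq_sum (hπ : LastInFirstOut π) (hinv : LastInFirstOut π⁻¹)
    (hfix : ∀ j, ¬ IsNestedFixedPoint π j) (i j : Fin n) :
    (if i < j ∧ π j < π i then 1 else 0) =
      (if j < π j ∧ i < j ∧ j < π i then 1 else 0) +
      (if π i < i ∧ π j < i ∧ i < j then 1 else 0) +
      (if i < π i ∧ π j < i ∧ i < j then 1 else 0) +
      (if π j < j ∧ i ≤ π j ∧ π j < π i then 1 else 0) := by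
  have hlifo : i < j → j < π j → j < π i → i < π i → π j < π i := hπ j i
  have hlifo' := hinv (π j) (π i)
  rw [inv_apply_eq_iff.2 rfl, inv_apply_eq_iff.2 rfl] at hlifo'
  have hi : ¬ (π i = i ∧ i < j ∧ π j < i) := fun ⟨hf, hij, hji⟩ =>
    hfix i ⟨hf, π j, j, hji, hij, Or.inr rfl⟩
  have hj : ¬ (π j = j ∧ i < j ∧ j < π i) := fun ⟨hf, hij, hji⟩ =>
    hfix j ⟨hf, i, π i, hij, hji, Or.inl rfl⟩
  have hinj : π i = π j → i = j := fun h => π.injective h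
  clear hπ hinv hfix
  split_ifs <;> omega

theorem inv_eq_sum_arcs (hπ : LastInFirstOut π) (hinv : LastInFirstOut π⁻¹)
    (hfix : ∀ j, ¬ IsNestedFixedPoint π j) :
    inv π = ∑ k, ((if k < π k then #{i | i < k ∧ k < π i} else 0) +
      (if π k < k then #{j | π j < k ∧ k < j} else 0) +
      (if k < π k then #{j | π j < k ∧ k < j} else 0) +
      if k < π⁻¹ k then upArcs π (k + 1) else 0) := by
  have hover : ∑ i, ∑ j, (if j < π j ∧ i < j ∧ j < π i then 1 else 0) =
      ∑ k, if k < π k then #{i | i < k ∧ k < π i} else 0 := by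
    rw [sum_comm]
    exact sum_congr rfl fun k _ => sum_ite_and _ _
  have hoverlap : ∑ i, ∑ j, (if π j < j ∧ i ≤ π j ∧ π j < π i then 1 else 0) =
      ∑ k : Fin n, if k < π⁻¹ k then upArcs π (k + 1) else 0 := by
    rw [sum_comm, ← Equiv.sum_comp π fun k : Fin n => if k < π⁻¹ k then upArcs π (k + 1) else 0]
    refine sum_congr rfl fun k _ => ?_
    rw [sum_ite_and, inv_apply_eq_iff.2 rfl, upArcs]
    simp only [Nat.lt_succ_iff, Nat.succ_le_iff, Fin.val_fin_le, Fin.val_fin_lt]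
  rw [inv, card_filter, ← univ_product_univ, sum_product]
  simp only [ite_inversion_eq_sum hπ hinv hfix, sum_add_distrib, hover, hoverlap, sum_ite_and]

/-- The contribution of a letter at height `h` to the number of inversions. The truncated
subtractions never occur in words of permutations, where only valleys and fixed points are at
height zero. -/
def Letter.inversions (h : ℕ) : Letter → ℕ
  | fixed => 0
  | valley => 3 * h + 1
  | peak => h - 1
  | doubleRise | doubleFall => 2 * h - 1

theorem inv_eq_sum_word (hπ : LastInFirstOut π) (hinv : LastInFirstOut π⁻¹)
    (hfix : ∀ j, ¬ IsNestedFixedPoint π j) :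
    inv π = ∑ k, (word π k).inversions (upArcs π k) := by
  rw [inv_eq_sum_arcs hπ hinv hfix]
  refine sum_congr rfl fun k _ => ?_
  have hover := card_arcs_over_add π k
  have hunder := card_arcs_under_add π k
  have hnext := upArcs_succ π k
  have hfixed := inv_apply_eq_iff (π := π) (i := k) (j := k)
  unfold word
  split_ifs at * <;> simp only [Letter.inversions] <;> omega

end Statistics

section ContinuedFractions

variable {R : Type*} [CommRing R]

/-- The tail of the infinite continued fraction that starts at level `h`. -/
noncomputable def jTail (d l : ℕ → R) (h : ℕ) : PowerSeries R :=
  PowerSeries.mk fun n => PowerSeries.coeff n (jConvergent d l n h)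

theorem X_pow_dvd_jTail_sub (d l : ℕ → R) (N h : ℕ) :
    PowerSeries.X ^ (N + 1) ∣ jTail d l h - jConvergent d l N h := by
  rw [PowerSeries.X_pow_dvd_iff]
  intro m hm
  have hdvd := jConvergent_sub_dvd d l m N h (Nat.lt_succ_iff.1 hm)
  rw [map_sub, jTail, PowerSeries.coeff_mk, ← neg_sub, ← map_sub,
    PowerSeries.X_pow_dvd_iff.1 hdvd m (by omega), neg_zero]

theorem jTail_eq (d l : ℕ → R) (h : ℕ) :
    jTail d l h = 1 + (PowerSeries.C (l h) * PowerSeries.X +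
      PowerSeries.C (d (h + 1)) * PowerSeries.X ^ 2 * jTail d l (h + 1)) * jTail d l h := by
  rw [← sub_eq_zero]
  ext n
  refine PowerSeries.X_pow_dvd_iff.1 (?_ : PowerSeries.X ^ (n + 1) ∣ _) n n.lt_succ_self
  have hconv : (1 - PowerSeries.C (l h) * PowerSeries.X
      - PowerSeries.C (d (h + 1)) * PowerSeries.X ^ 2 * jConvergent d l n (h + 1)) *
      jConvergent d l (n + 1) h = 1 :=
    PowerSeries.mul_invOfUnit _ 1 (by simp)
  have hnext := X_pow_dvd_jTail_sub d l n (h + 1)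
  have hself := (pow_dvd_pow PowerSeries.X (n + 1).le_succ).trans
    (X_pow_dvd_jTail_sub d l (n + 1) h)
  convert dvd_sub (hself.mul_left (1 - PowerSeries.C (l h) * PowerSeries.X
      - PowerSeries.C (d (h + 1)) * PowerSeries.X ^ 2 * jConvergent d l n (h + 1)))
    (hnext.mul_left (PowerSeries.C (d (h + 1)) * PowerSeries.X ^ 2 * jTail d l h)) using 1
  linear_combination hconv

end ContinuedFractions

section PathSums

variable {R : Type*} [CommSemiring R]

/-- The sum of the weights of the Motzkin words of length `n` from height `h`, where a letter `s`
at height `k` has weight `W k s`. -/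
def pathSum (W : ℕ → Letter → R) (n : ℕ) (h : ℤ) : R :=
  ∑ u : Fin n → Letter with IsMotzkinFrom h u, ∏ i : Fin n, W (h + wordHeight u i).toNat (u i)

theorem wordHeight_zero {n : ℕ} (u : Fin n → Letter) : wordHeight u 0 = 0 := by
  simp [wordHeight]

theorem wordHeight_cons_succ {n : ℕ} (s : Letter) (u : Fin n → Letter) (p : ℕ) :
    wordHeight (Fin.cons s u : Fin (n + 1) → Letter) (p + 1) = s.rise + wordHeight u p := by
  simp [wordHeight, sum_filter, Fin.sum_univ_succ]

theorem isMotzkinFrom_cons_iff {n : ℕ} {h : ℤ} {s : Letter} {u : Fin n → Letter} :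
    IsMotzkinFrom h (Fin.cons s u : Fin (n + 1) → Letter) ↔
      s.Fits h ∧ IsMotzkinFrom (h + s.rise) u := by
  simp only [IsMotzkinFrom, Fin.forall_fin_succ, Fin.cons_zero, Fin.cons_succ, Fin.val_zero,
    Fin.val_succ, wordHeight_zero, wordHeight_cons_succ, add_zero, add_assoc, and_assoc]

theorem pathSum_zero (W : ℕ → Letter → R) (h : ℤ) : pathSum W 0 h = if h = 0 then 1 else 0 := by
  by_cases hh : h = 0 <;> simp [pathSum, IsMotzkinFrom, wordHeight_zero, hh]

theorem pathSum_succ (W : ℕ → Letter → R) (n : ℕ) (h : ℤ) :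
    pathSum W (n + 1) h = ∑ s with s.Fits h, W h.toNat s * pathSum W n (h + s.rise) := by
  rw [pathSum, sum_filter, ← (Fin.consEquiv fun _ : Fin (n + 1) => Letter).sum_comp,
    Fintype.sum_prod_type, sum_filter]
  refine sum_congr rfl fun s _ => ?_
  simp only [Fin.consEquiv, Equiv.coe_fn_mk, isMotzkinFrom_cons_iff, ite_and]
  split_ifs
  · rw [pathSum, mul_sum, sum_filter]
    refine sum_congr rfl fun u _ => if_congr Iff.rfl ?_ rfl
    simp only [Fin.prod_univ_succ, Fin.cons_zero, Fin.cons_succ, Fin.val_zero, Fin.val_succ,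
      wordHeight_zero, wordHeight_cons_succ, add_zero, add_assoc]
  · exact sum_const_zero

theorem pathSum_succ_zero (W : ℕ → Letter → R) (n : ℕ) :
    pathSum W (n + 1) 0 = W 0 .fixed * pathSum W n 0 + W 0 .valley * pathSum W n 1 := by
  have hfits : ({s | s.Fits 0} : Finset Letter) = {.fixed, .valley} := by decide
  rw [pathSum_succ, hfits, sum_pair (by decide)]
  rfl

theorem pathSum_succ_succ (W : ℕ → Letter → R) (n h : ℕ) :
    pathSum W (n + 1) (h + 1 : ℕ) = W (h + 1) .valley * pathSum W n (h + 2 : ℕ) +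
      (W (h + 1) .doubleRise + W (h + 1) .doubleFall) * pathSum W n (h + 1 : ℕ) +
      W (h + 1) .peak * pathSum W n h := by
  have hfits : ({s | s.Fits (h + 1 : ℕ)} : Finset Letter) =
      {.valley, .doubleRise, .doubleFall, .peak} := by
    ext s
    rw [mem_filter_univ]
    cases s <;> simp [Letter.Fits] <;> omega
  rw [pathSum_succ, hfits, sum_insert (by decide), sum_insert (by decide), sum_pair (by decide)]
  have hvalley : ((h + 1 : ℕ) : ℤ) + Letter.valley.rise = (h + 2 : ℕ) := by rfl
  have hpeak : ((h + 1 : ℕ) : ℤ) + Letter.peak.rise = h := by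
    push_cast; exact add_neg_cancel_right _ _
  have hrise : ((h + 1 : ℕ) : ℤ) + Letter.doubleRise.rise = (h + 1 : ℕ) := by rfl
  have hfall : ((h + 1 : ℕ) : ℤ) + Letter.doubleFall.rise = (h + 1 : ℕ) := by rfl
  rw [hvalley, hpeak, hrise, hfall, Int.toNat_natCast, add_mul, add_assoc, add_assoc]

theorem coeff_eq_pathSum {W : ℕ → Letter → R} {G : ℕ → PowerSeries R}
    (hzero : G 0 = 1 + PowerSeries.X *
      (PowerSeries.C (W 0 .fixed) * G 0 + PowerSeries.C (W 0 .valley) * G 1))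
    (hsucc : ∀ h, G (h + 1) = PowerSeries.X * (PowerSeries.C (W (h + 1) .valley) * G (h + 2) +
      PowerSeries.C (W (h + 1) .doubleRise + W (h + 1) .doubleFall) * G (h + 1) +
      PowerSeries.C (W (h + 1) .peak) * G h))
    (n h : ℕ) : PowerSeries.coeff n (G h) = pathSum W n h := by
  induction n generalizing h with
  | zero =>
    rw [pathSum_zero]
    cases h with
    | zero =>
      rw [hzero, map_add, PowerSeries.coeff_zero_X_mul]
      simp
    | succ h => rw [hsucc, PowerSeries.coeff_zero_X_mul, if_neg (by omega)]
  | succ n ih =>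
    cases h with
    | zero =>
      rw [hzero, map_add, PowerSeries.coeff_succ_X_mul, map_add, PowerSeries.coeff_C_mul,
        PowerSeries.coeff_C_mul, ih, ih, Nat.cast_zero, Nat.cast_one, pathSum_succ_zero,
        PowerSeries.coeff_one, if_neg n.succ_ne_zero, zero_add]
    | succ h =>
      rw [hsucc, PowerSeries.coeff_succ_X_mul, map_add, map_add, PowerSeries.coeff_C_mul,
        PowerSeries.coeff_C_mul, PowerSeries.coeff_C_mul, ih, ih, ih, pathSum_succ_succ]

/-- Cut at its first descents to the heights below `h`, a path from height `h` is a sequence of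
excursions, each counted by a tail of the continued fraction, separated by the descents. -/
theorem mk_pathSum_eq_jFraction {R : Type*} [CommRing R] {W : ℕ → Letter → R} {d l : ℕ → R}
    (hd : ∀ h, d (h + 1) = W h .valley * W (h + 1) .peak) (hzero : l 0 = W 0 .fixed)
    (hsucc : ∀ h, l (h + 1) = W (h + 1) .doubleRise + W (h + 1) .doubleFall) :
    PowerSeries.mk (fun n => pathSum W n 0) = jFraction d l := by
  let G (h : ℕ) : PowerSeries R := jTail d l 0 *
    ∏ k ∈ range h, (PowerSeries.C (W (k + 1) .peak) * PowerSeries.X * jTail d l (k + 1))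
  have hG (h : ℕ) : G (h + 1) =
      G h * (PowerSeries.C (W (h + 1) .peak) * PowerSeries.X * jTail d l (h + 1)) := by
    simp only [G, prod_range_succ, mul_assoc]
  have hG0 : G 0 = jTail d l 0 := mul_one _
  ext n
  rw [PowerSeries.coeff_mk, ← Nat.cast_zero, ← coeff_eq_pathSum (G := G) ?_ fun h => ?_, hG0]
  · rfl
  · have htail := jTail_eq d l 0
    rw [hzero, hd, map_mul] at htail
    rw [hG, hG0]
    linear_combination htail
  · have htail := jTail_eq d l (h + 1)
    rw [hsucc, hd, map_mul] at htail
    rw [hG (h + 1), hG h]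
    linear_combination G h * PowerSeries.C (W (h + 1) .peak) * PowerSeries.X * htail

theorem pathSum_one_eq_catalan (n : ℕ) : pathSum (fun _ _ => 1) n 0 = catalan n := by
  let c := PowerSeries.catalanSeries
  have hc : c ^ 2 * PowerSeries.X + 1 = c := PowerSeries.catalanSeries_sq_mul_X_add_one
  have hcoeff := coeff_eq_pathSum (W := fun _ _ => (1 : ℕ))
    (G := fun h => PowerSeries.X ^ h * c ^ (2 * h + 1)) ?_ (fun h => ?_) n 0
  · simpa [c] using hcoeff.symm
  · calc PowerSeries.X ^ 0 * c ^ (2 * 0 + 1)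
        = (c * (c ^ 2 * PowerSeries.X + 1)) * PowerSeries.X + 1 := by rw [hc, ← sq, hc]; ring
      _ = _ := by simp only [map_one]; ring
  · calc PowerSeries.X ^ (h + 1) * c ^ (2 * (h + 1) + 1)
        = PowerSeries.X ^ (h + 1) * c ^ (2 * h + 1) * (c ^ 2 * PowerSeries.X + 1) ^ 2 := by
          rw [hc]; ring
      _ = _ := by simp only [map_add, map_one]; ring

end PathSums

section Enumeration

variable {n : ℕ} {R : Type*} [CommSemiring R]

/-- The contribution of a letter at height `h` to the weight of a permutation, in which `x`, `v`,
`w`, `t` and `q` mark fixed points, excedances, double excedances, cycles and inversions. -/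
def letterWeight (x v w t q : R) (h : ℕ) (s : Letter) : R :=
  (match s with
    | .fixed => x * t
    | .valley => v * t
    | .doubleRise => v * w
    | _ => 1) * q ^ s.inversions h

theorem weight_eq_prod_letterWeight {π : Equiv.Perm (Fin n)} (hπ : π ∈ unimodalNoncrossing n)
    (x v w t q : R) :
    x ^ fp π * v ^ exc π * w ^ dexc π * t ^ cyc π * q ^ inv π =
      ∏ i : Fin n, letterWeight x v w t q (wordHeight (word π) i).toNat (word π i) := by
  obtain ⟨hlast, hlast', hfix⟩ := mem_unimodalNoncrossing_iff.1 hπ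
  rw [fp_eq_card_word, exc_eq_card_word, dexc_eq_card_word,
    cyc_eq_card_word (hlast.uniqueValleys hlast'), inv_eq_sum_word hlast hlast' hfix]
  simp only [card_filter, ← prod_pow_eq_pow_sum, ← prod_mul_distrib, wordHeight_word,
    Int.toNat_natCast]
  refine prod_congr rfl fun i _ => ?_
  cases word π i <;> simp [letterWeight, Letter.opens]

theorem sum_weight_eq_pathSum (x v w t q : R) (n : ℕ) :
    ∑ π ∈ unimodalNoncrossing n, x ^ fp π * v ^ exc π * w ^ dexc π * t ^ cyc π * q ^ inv π =
      pathSum (letterWeight x v w t q) n 0 := by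
  rw [sum_congr rfl fun π hπ => weight_eq_prod_letterWeight hπ x v w t q,
    sum_comp_word (bijOn_word_unimodalNoncrossing n) fun u =>
      ∏ i : Fin n, letterWeight x v w t q (wordHeight u i).toNat (u i), pathSum]
  simp only [zero_add]

theorem card_unimodalNoncrossing (n : ℕ) : #(unimodalNoncrossing n) = catalan n := by
  rw [← pathSum_one_eq_catalan, card_eq_sum_ones,
    sum_comp_word (bijOn_word_unimodalNoncrossing n) fun _ => 1, pathSum]
  simp only [prod_const_one]

theorem card_filter_statistics_eq (n a b c : ℕ) :
    #{π ∈ unimodalNoncrossing n | fp π = a ∧ exc π = b ∧ dexc π = c} =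
      #{π ∈ avoiding321 n | fp π = a ∧ exc π = b ∧ dexc π = c} := by
  simpa only [fp_eq_card_word, exc_eq_card_word, dexc_eq_card_word] using
    card_filter_word_eq n fun u =>
      #{i | u i = .fixed} = a ∧ #{i | (u i).opens} = b ∧ #{i | u i = .doubleRise} = c

theorem mk_sum_weight_eq_jFraction {R : Type*} [CommRing R] (x v w t q : R) :
    PowerSeries.mk (fun n : ℕ => ∑ π ∈ unimodalNoncrossing n,
        x ^ fp π * v ^ exc π * w ^ dexc π * t ^ cyc π * q ^ inv π) =
      jFraction (fun h : ℕ => v * t * q ^ (4 * h - 3))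
        (fun h : ℕ => if h = 0 then x * t else (1 + v * w) * q ^ (2 * h - 1)) := by
  simp only [sum_weight_eq_pathSum]
  refine mk_pathSum_eq_jFraction (fun h => ?_) ?_ fun h => ?_
  · have hexp : 4 * (h + 1) - 3 = 3 * h + 1 + (h + 1 - 1) := by omega
    simp only [letterWeight, Letter.inversions, one_mul, hexp, pow_add, mul_assoc]
  · simp [letterWeight, Letter.inversions]
  · simp only [letterWeight, Letter.inversions, if_neg h.succ_ne_zero]
    ring

end Enumeration

end PermCycles

/-- The coefficients `x, v, w, t, q` are arbitrary elements of an arbitrary commutative ring; taking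
them to be the variables of a polynomial ring gives the identity for formal variables. The
truncated subtractions matter only at `h = 0`, where neither value is used. -/
theorem mainTheorem9 :
    (∀ n : ℕ, (unimodalNoncrossing n).card = catalan n) ∧
    (∀ n a b c : ℕ,
      ((unimodalNoncrossing n).filter fun π => fp π = a ∧ exc π = b ∧ dexc π = c).card =
        ((avoiding321 n).filter fun π => fp π = a ∧ exc π = b ∧ dexc π = c).card) ∧
    (∀ (R : Type*) [CommRing R] (x v w t q : R),
      PowerSeries.mk (fun n : ℕ => ∑ π ∈ unimodalNoncrossing n,
          x ^ fp π * v ^ exc π * w ^ dexc π * t ^ cyc π * q ^ inv π) =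
        jFraction (fun h : ℕ => v * t * q ^ (4 * h - 3))
          (fun h : ℕ => if h = 0 then x * t else (1 + v * w) * q ^ (2 * h - 1))) := by
  exact ⟨card_unimodalNoncrossing, card_filter_statistics_eq,
    fun R _ x v w t q => mk_sum_weight_eq_jFraction x v w t q⟩
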